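/- Let $G$ be a connected simple undirected $k$-regular graph on $n\ge 2$ vertices with adjacency matrix $A$, whose eigenvalues are $\lambda_1(A)\ge\lambda_2(A)\ge\dots\ge\lambda_n(A)$, and put $|\lambda'(A)|:=\max\{|\lambda_2(A)|,|\lambda_n(A)|\}$. Let $d>0$, and let $F:\mathbb R^n\times\mathbb R\to\mathbb R^n$ be either the Hopfield form $F(x,u)=-dx+uA\tanh(x)$ or the firing-rate form $F(x,u)=-dx+\tanh(uAx)$ of nonlinear opinion dynamics $\dot x=F(x,u)$ ($\tanh$ acts entrywise). Let $u^\star=d/k$, $J^\star=D_xF(0,u^\star)$, and let $P$ be the orthogonal projection onto $\operatorname{range}J^\star$. Then: 1. The system has a supercritical pitchfork bifurcation of equilibria at $(x,u)=(0,d/k)$. That is, $F(0,u^\star)=0$; $0$ is an eigenvalue of $J^\star$ of geometric and algebraic multiplicity one and all other eigenvalues of $J^\star$ have nonzero real part; and the scalar Lyapunov–Schmidt reduced function $g(t,u)=\langle w, F(tv+\varphi(tv,u),u)\rangle$, with a local implicit map $\varphi$ as in part 2 and unit vectors $v\in\ker J^\star$, $w\in(\operatorname{range}J^\star)^\perp$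 with $\langle w,v\rangle>0$, can be written near $(0,u^\star)$ as $g=S\cdot(\Lambda X-X^3)$ with smooth $S(t,u)>0$, $X(t,u)$, $\Lambda(u)$ such that $X(0,u^\star)=0$, $\Lambda(u^\star)=0$, $\partial_tX>0$, $\Lambda'>0$. Moreover $\ker J^\star=\operatorname{span}\{\mathbf 1_n\}$. 2. For all $R_\parallel,R_\perp$ with $$0<R_\parallel<\frac{d\,(k-\lambda_2(A))}{k\,|\lambda'(A)|},\qquad R_\perp>0,$$ the Lyapunov–Schmidt reduction at $(0,u^\star)$ is valid on the open Euclidean balls $B_\parallel\subset\ker J^\star\times\mathbb R$ of radius $R_\parallel$ about $(0,u^\star)$ and $B_\perp\subset(\ker J^\star)^\perp$ of radius $R_\perp$ about $0$. That is, there is a smooth map $\varphi:B_\parallel\to B_\perp$ with $\varphi(0,u^\star)=0$ such that for all $(\alpha,u)\in B_\parallel$ and $\beta\in B_\perp$ one has $P\,F(\alpha+\beta,u)=0$ if and only if $\beta=\varphi(\alpha,u)$; consequently $F(\alpha+\beta,u)=0$ if and only if $\beta=\varphi(\alpha,u)$ and the reduced equation $(I-P)F(\alpha+\varphi(\alpha,u),u)=0$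 holds. -/

import Mathlib

open scoped ContDiff

noncomputable section

namespace LSR

section General

variable {E : Type*} [NormedAddCommGroup E] [InnerProductSpace ℝ E] [FiniteDimensional ℝ E]

/-- The Jacobian `J⋆ = D_x Φ(x⋆, u⋆)` of a one-parameter family of vector fields `x' = Φ(x, u)`. -/
def jac (Φ : E → ℝ → E) (xs : E) (us : ℝ) : E →ₗ[ℝ] E :=
  (fderiv ℝ (fun x => Φ x us) xs : E →L[ℝ] E)

/-- The critical subspace `ker J⋆`. -/
abbrev critSpace (Φ : E → ℝ → E) (xs : E) (us : ℝ) : Submodule ℝ E :=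
  LinearMap.ker (jac Φ xs us)

/-- The subspace `range J⋆`. -/
abbrev rangeSpace (Φ : E → ℝ → E) (xs : E) (us : ℝ) : Submodule ℝ E :=
  LinearMap.range (jac Φ xs us)

/-- The open Euclidean ball of radius `R` in `ker J⋆ × ℝ`, centred at `(α₀, u⋆)`, where `α₀` is the
component of `x⋆` in `ker J⋆`. -/
def parBall (Φ : E → ℝ → E) (xs : E) (us R : ℝ) : Set (critSpace Φ xs us × ℝ) :=
  {z | √(‖z.1 - (critSpace Φ xs us).orthogonalProjectionOnto xs‖ ^ 2 + (z.2 - us) ^ 2) < R}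

/-- The open Euclidean ball of radius `R` in `(ker J⋆)ᗮ`, centred at the component `β₀` of `x⋆`. -/
def perpBall (Φ : E → ℝ → E) (xs : E) (us R : ℝ) : Set (critSpace Φ xs us)ᗮ :=
  Metric.ball ((critSpace Φ xs us)ᗮ.orthogonalProjectionOnto xs) R

/-- The Lyapunov–Schmidt reduction of `Φ = 0` at the singular point `(x⋆, u⋆)` is valid on the
balls of radii `Rpar` (in `ker J⋆ × ℝ`) and `Rperp` (in `(ker J⋆)ᗮ`), with implicit map `φ`.
States are written `x = α + β` with `α ∈ ker J⋆` and `β ∈ (ker J⋆)ᗮ`. -/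
structure IsValidReduction (Φ : E → ℝ → E) (xs : E) (us Rpar Rperp : ℝ)
    (φ : critSpace Φ xs us × ℝ → (critSpace Φ xs us)ᗮ) : Prop where
  smooth : ContDiffOn ℝ ∞ φ (parBall Φ xs us Rpar)
  mapsTo : Set.MapsTo φ (parBall Φ xs us Rpar) (perpBall Φ xs us Rperp)
  base : φ ((critSpace Φ xs us).orthogonalProjectionOnto xs, us) =
    (critSpace Φ xs us)ᗮ.orthogonalProjectionOnto xs
  /-- In the region, the graph of `φ` is exactly the solution set of the equation `Φ = 0`
  projected to `range J⋆`. -/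
  solves_iff : ∀ z ∈ parBall Φ xs us Rpar, ∀ β ∈ perpBall Φ xs us Rperp,
    (rangeSpace Φ xs us).starProjection (Φ (z.1 + β) z.2) = 0 ↔ β = φ z
  /-- In the region, the equilibria are the zeros `(α, u)` of the reduced equation, lifted
  by `φ`. -/
  equilibria_iff : ∀ z ∈ parBall Φ xs us Rpar, ∀ β ∈ perpBall Φ xs us Rperp,
    Φ (z.1 + β) z.2 = 0 ↔
      β = φ z ∧ (rangeSpace Φ xs us)ᗮ.starProjection (Φ (z.1 + φ z) z.2) = 0

end General

/-- A scalar bifurcation problem `g(t, u) = 0` is, near `(t₀, u₀)`, equivalent to the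
supercritical pitchfork normal form `Λ X - X³`: there are a smooth positive factor `S` and a smooth
orientation preserving change of coordinates `(t, u) ↦ (X (t, u), Λ u)` taking `(t₀, u₀)` to
`(0, 0)` such that `g = S * (Λ * X - X ^ 3)` near `(t₀, u₀)`. -/
def IsSupercriticalPitchforkGerm (g : ℝ → ℝ → ℝ) (t₀ u₀ : ℝ) : Prop :=
  ∃ (U : Set (ℝ × ℝ)) (I : Set ℝ) (S X : ℝ × ℝ → ℝ) (Λ : ℝ → ℝ),
    IsOpen U ∧ (t₀, u₀) ∈ U ∧ IsOpen I ∧ (∀ z ∈ U, z.2 ∈ I) ∧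
    ContDiffOn ℝ ∞ S U ∧ ContDiffOn ℝ ∞ X U ∧ ContDiffOn ℝ ∞ Λ I ∧
    X (t₀, u₀) = 0 ∧ Λ u₀ = 0 ∧
    (∀ z ∈ U, 0 < S z ∧ 0 < deriv (fun t => X (t, z.2)) z.1) ∧
    (∀ u ∈ I, 0 < deriv Λ u) ∧
    ∀ z ∈ U, g z.1 z.2 = S z * (Λ z.2 * X z - X z ^ 3)

/-- The family `x' = Φ(x, u)` has a supercritical pitchfork bifurcation of equilibria at
`(x⋆, u⋆)`: the point is an equilibrium, `0` is an eigenvalue of `J⋆` of geometric and algebraic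
multiplicity one, the other complex eigenvalues are off the imaginary axis, and the scalar
Lyapunov–Schmidt reduced equation, in unit vectors `v` of `ker J⋆` and `w` of `(range J⋆)ᗮ` with
`0 < ⟪w, v⟫`, is equivalent to the supercritical pitchfork normal form. -/
def IsSupercriticalPitchfork {E : Type*} [NormedAddCommGroup E] [InnerProductSpace ℝ E]
    [FiniteDimensional ℝ E] (Φ : E → ℝ → E) (xs : E) (us : ℝ) : Prop :=
  Φ xs us = 0 ∧
  Module.finrank ℝ (critSpace Φ xs us) = 1 ∧
  Module.finrank ℝ (Module.End.maxGenEigenspace (jac Φ xs us) 0) = 1 ∧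
  (∀ μ : ℂ, Polynomial.aeval μ (jac Φ xs us).charpoly = 0 → μ ≠ 0 → μ.re ≠ 0) ∧
  ∃ (v : critSpace Φ xs us) (w : ((rangeSpace Φ xs us)ᗮ : Submodule ℝ E)) (r ρ : ℝ)
    (φ : critSpace Φ xs us × ℝ → (critSpace Φ xs us)ᗮ),
    ‖v‖ = 1 ∧ ‖w‖ = 1 ∧ 0 < inner ℝ (w : E) (v : E) ∧ 0 < r ∧ 0 < ρ ∧
    IsValidReduction Φ xs us r ρ φ ∧
    IsSupercriticalPitchforkGerm
      (fun t u => inner ℝ (w : E) (Φ ((t • v : critSpace Φ xs us) + φ (t • v, u)) u))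
      (inner ℝ (v : E) xs) us

section Network

/-- The adjacency matrix of a simple graph is symmetric. -/
theorem adjMatrix_isHermitian {V : Type*} (G : SimpleGraph V) [DecidableRel G.Adj] :
    (G.adjMatrix ℝ).IsHermitian := by
  rw [Matrix.IsHermitian, Matrix.conjTranspose_eq_transpose_of_trivial]
  exact G.isSymm_adjMatrix

variable {V : Type*} [Fintype V] [DecidableEq V] (G : SimpleGraph V) [DecidableRel G.Adj]

/-- Hopfield form of nonlinear opinion dynamics, `Φ(x, u) = -d x + u A tanh(x)`. -/
def hopfieldNOD (d : ℝ) (x : EuclideanSpace ℝ V) (u : ℝ) : EuclideanSpace ℝ V :=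
  -(d • x) + u • WithLp.toLp 2 ((G.adjMatrix ℝ).mulVec fun j => Real.tanh (x j))

/-- Firing-rate form of nonlinear opinion dynamics, `Ψ(x, u) = -d x + tanh(u A x)`. -/
def firingNOD (d : ℝ) (x : EuclideanSpace ℝ V) (u : ℝ) : EuclideanSpace ℝ V :=
  -(d • x) + WithLp.toLp 2 (fun i => Real.tanh (u * (G.adjMatrix ℝ).mulVec (fun j => x j) i))

/-- The second largest eigenvalue `λ₂(A)` of the adjacency matrix, counted with multiplicity. -/
def lambdaTwo (h : 2 ≤ Fintype.card V) : ℝ :=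
  (adjMatrix_isHermitian G).eigenvalues₀ ⟨1, by omega⟩

/-- The smallest eigenvalue `λₙ(A)` of the adjacency matrix. -/
def lambdaMin (h : 2 ≤ Fintype.card V) : ℝ :=
  (adjMatrix_isHermitian G).eigenvalues₀ ⟨Fintype.card V - 1, by omega⟩

/-- `|λ'(A)| = max (|λ₂(A)|, |λₙ(A)|)`. -/
def lambdaPrime (h : 2 ≤ Fintype.card V) : ℝ :=
  max |lambdaTwo G h| |lambdaMin G h|

/-- The all-ones vector. -/
def ones (V : Type*) [Fintype V] : EuclideanSpace ℝ V := WithLp.toLp 2 fun _ => 1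

end Network

end LSR

end

namespace LSR

/-! ### Analytic facts about `tanh`: firm nonexpansiveness and cubic contact with the identity. -/

section Tanh

/-! Regularity makes the consensus line spanned by the all-ones vector invariant for every `u`, and
the Jacobian `-d + u A` at the origin is symmetric with this line as kernel at `u = d / k`. So the
orthogonal complement of the range is again the consensus line, the projected equation says that the
field lies on that line, and the implicit map is identically zero. Validity reduces to one
uniqueness claim: if `β` is orthogonal to the ones vector and the field at `a • ones + β` lies on
the line, then `β = 0`. No bound on `β` enters, hence the arbitrary transverse radius.

Uniqueness is an energy estimate. Entrywise `tanh` is firmly nonexpansive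
(`norm_sq_tanhMap_sub_le`), so pairing the transverse equation with a suitable vector forces `β = 0`
once the quadratic form of `u A` on the complement of the line is at most `c < d` times the squared
norm (`eq_zero_of_neg_smul_add_smul_map_mem`, `eq_zero_of_neg_smul_add_mem`). That bound follows
from `u λ₂ < d` when `u > 0`, and from a bound through `λₙ` when `u ≤ 0`; the stated radius
guarantees both (`exists_bound_of_abs_sub_lt`).

With zero implicit map the reduced function is the field on the line, a rescaling of `tanh y - (d /
(u k)) y`. Writing `y - tanh y = y ^ 3 * m y ^ 2` with `m > 0` smooth gives the pitchfork normal
form explicitly, with `Λ = 1 - d / (u k)` and `X = y * m y`. -/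

theorem hasDerivAt_tanh (x : ℝ) : HasDerivAt Real.tanh (1 - Real.tanh x ^ 2) x := by
  have hc := (Real.cosh_pos x).ne'
  have h := (Real.hasDerivAt_sinh x).div (Real.hasDerivAt_cosh x) hc
  have he : Real.tanh = Real.sinh / Real.cosh := by
    funext y; exact Real.tanh_eq_sinh_div_cosh y
  rw [he]
  refine h.congr_deriv ?_
  rw [Pi.div_apply]
  field_simp

theorem tanh_strictMono : StrictMono Real.tanh :=
  strictMono_of_deriv_pos fun x => by
    rw [(hasDerivAt_tanh x).deriv]
    linarith [Real.tanh_sq_lt_one x]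

theorem monotone_sub_tanh : Monotone fun x : ℝ => x - Real.tanh x :=
  monotone_of_hasDerivAt_nonneg (fun x => (hasDerivAt_id x).sub (hasDerivAt_tanh x))
    fun x => by simpa using sq_nonneg (Real.tanh x)

/-- `tanh` is increasing and `1`-Lipschitz. -/
theorem sq_tanh_sub_le (x y : ℝ) :
    (Real.tanh x - Real.tanh y) ^ 2 ≤ (x - y) * (Real.tanh x - Real.tanh y) := by
  rcases le_total x y with h | h
  · nlinarith [tanh_strictMono.monotone h, monotone_sub_tanh h]
  · nlinarith [tanh_strictMono.monotone h, monotone_sub_tanh h]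

theorem analyticAt_tanh (x : ℝ) : AnalyticAt ℝ Real.tanh x := by
  have he : Real.tanh = fun y => Real.sinh y / Real.cosh y := by
    funext y; exact Real.tanh_eq_sinh_div_cosh y
  rw [he]
  exact Real.analyticAt_sinh.fun_div Real.analyticAt_cosh (Real.cosh_pos x).ne'

/-- The derivative is `tanh ^ 2`, and `tanh` has a simple zero, so the order is `2 + 1`. -/
theorem analyticOrderAt_sub_tanh :
    analyticOrderAt (fun x : ℝ => x - Real.tanh x) 0 = 3 := by
  have h1 : analyticOrderAt Real.tanh 0 = 1 := by
    have h := (analyticAt_tanh 0).analyticOrderAt_deriv_add_one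
    have h0 : analyticOrderAt (deriv Real.tanh) 0 = 0 := by
      rw [analyticOrderAt_eq_zero]
      right
      simp [(hasDerivAt_tanh 0).deriv]
    rw [h0] at h
    simpa using h.symm
  have hf : AnalyticAt ℝ (fun x : ℝ => x - Real.tanh x) 0 := analyticAt_id.fun_sub (analyticAt_tanh 0)
  have h := hf.analyticOrderAt_deriv_add_one
  have hd : deriv (fun x : ℝ => x - Real.tanh x) = Real.tanh ^ 2 := by
    funext x
    have := ((hasDerivAt_id x).sub (hasDerivAt_tanh x)).deriv
    simpa using! this
  rw [hd, analyticOrderAt_pow (analyticAt_tanh 0), h1] at h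
  simp only [Real.tanh_zero, sub_zero] at h
  rw [← h]
  norm_num

/-- Near `0`, `x - tanh x = x ^ 3 * m x ^ 2` with `m` smooth and positive. -/
theorem exists_sub_tanh_eq_cube_mul_sq :
    ∃ (W : Set ℝ) (m : ℝ → ℝ), IsOpen W ∧ (0 : ℝ) ∈ W ∧ ContDiffOn ℝ ∞ m W ∧
      (∀ x ∈ W, 0 < m x) ∧ (∀ x ∈ W, 0 < deriv (fun y => y * m y) x) ∧
      ∀ x ∈ W, x - Real.tanh x = x ^ 3 * m x ^ 2 := by
  have hf : AnalyticAt ℝ (fun x : ℝ => x - Real.tanh x) 0 := analyticAt_id.fun_sub (analyticAt_tanh 0)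
  obtain ⟨h, ha, h0, hev⟩ := (hf.analyticOrderAt_eq_natCast (n := 3)).1 analyticOrderAt_sub_tanh
  simp only [sub_zero, smul_eq_mul] at hev
  -- The sign comes from `x - tanh x ≥ 0` for `x > 0`: the cofactor `h` is nonnegative to the right
  -- of `0`, and `h 0 ≠ 0`.
  have hpos : 0 < h 0 := by
    refine lt_of_le_of_ne ?_ h0.symm
    have hc : Filter.Tendsto h (nhdsWithin 0 (Set.Ioi 0)) (nhds (h 0)) :=
      ha.continuousAt.tendsto.mono_left nhdsWithin_le_nhds
    refine ge_of_tendsto hc ?_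
    filter_upwards [nhdsWithin_le_nhds hev, self_mem_nhdsWithin] with x hx hx0
    have hx0' : 0 < x := hx0
    have h1 := monotone_sub_tanh hx0'.le
    simp only [Real.tanh_zero, sub_zero] at h1
    rw [hx] at h1
    exact nonneg_of_mul_nonneg_right h1 (by positivity)
  -- The witness is `m = √h`, written as `exp (log h / 2)` to see that it is analytic where `h > 0`.
  have hm : AnalyticAt ℝ (fun x => Real.sqrt (h x)) 0 := by
    have : AnalyticAt ℝ (fun x => Real.exp (Real.log (h x) / 2)) 0 := by
      have := ha.log hpos
      fun_prop
    refine this.congr ?_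
    filter_upwards [ha.continuousAt.eventually (lt_mem_nhds hpos)] with x hx
    rw [Real.exp_half, Real.exp_log hx]
  have hX : AnalyticAt ℝ (fun y => y * Real.sqrt (h y)) 0 := analyticAt_id.fun_mul hm
  have hX0 : 0 < deriv (fun y => y * Real.sqrt (h y)) 0 := by
    have := ((hasDerivAt_id (0 : ℝ)).mul hm.differentiableAt.hasDerivAt).deriv
    simp only [id, one_mul, zero_mul, add_zero] at this
    have h2 : deriv (fun y => y * Real.sqrt (h y)) 0 = Real.sqrt (h 0) := by simpa using! this
    rw [h2]
    exact Real.sqrt_pos.2 hpos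
  have hall := (hm.eventually_analyticAt.and
    ((ha.continuousAt.eventually (lt_mem_nhds hpos)).and
      ((hX.deriv.continuousAt.eventually (lt_mem_nhds hX0)).and hev)))
  obtain ⟨W, hW, hWo, h0W⟩ := eventually_nhds_iff.1 hall
  refine ⟨W, fun x => Real.sqrt (h x), hWo, h0W, ?_, ?_, ?_, ?_⟩
  · exact fun x hx => (hW x hx).1.contDiffAt.contDiffWithinAt
  · exact fun x hx => Real.sqrt_pos.2 (hW x hx).2.1
  · exact fun x hx => (hW x hx).2.2.1
  · intro x hx
    rw [Real.sq_sqrt (hW x hx).2.1.le]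
    exact (hW x hx).2.2.2

end Tanh

/-! ### Pitchfork normal form of the scalar family. -/

section Germ

/-- Scalar families `M(u) (tanh y - (d / (u k)) y)` with `y = κ(u) t` have a supercritical
pitchfork at `(0, d / k)`. -/
theorem isSupercriticalPitchforkGerm_of_tanh {d k : ℝ} (hd : 0 < d) (hk : 0 < k) {M κ : ℝ → ℝ}
    (hM : ContDiff ℝ ∞ M) (hκ : ContDiff ℝ ∞ κ) (hMpos : ∀ u, 0 < u → 0 < M u)
    (hκpos : ∀ u, 0 < u → 0 < κ u) {g : ℝ → ℝ → ℝ}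
    (hg : ∀ t u, 0 < u → g t u = M u * (Real.tanh (κ u * t) - d / (u * k) * (κ u * t))) :
    IsSupercriticalPitchforkGerm g 0 (d / k) := by
  obtain ⟨W, m, hWo, h0W, hmc, hm0, hmd, hme⟩ := exists_sub_tanh_eq_cube_mul_sq
  have hY : ContDiff ℝ ∞ fun z : ℝ × ℝ => κ z.2 * z.1 := by fun_prop
  have hmY : ContDiffOn ℝ ∞ (fun z : ℝ × ℝ => m (κ z.2 * z.1))
      {z | 0 < z.2 ∧ κ z.2 * z.1 ∈ W} :=
    hmc.comp hY.contDiffOn fun z hz => hz.2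
  have hΛ : ∀ u : ℝ, 0 < u → HasDerivAt (fun u => 1 - d / (u * k)) (d * k / (u * k) ^ 2) u := by
    intro u hu
    have h1 := ((hasDerivAt_const u d).div ((hasDerivAt_id u).mul_const k)
      (by simp [hu.ne', hk.ne'])).const_sub 1
    refine h1.congr_deriv ?_
    simp only [id]
    ring
  -- With `y = κ t`, the family is `M (Λ y - y ^ 3 m ^ 2)`. Absorbing `m` into `X = y m` makes the
  -- cubic term `X ^ 3 / m`, so `S = M / m`.
  refine ⟨{z | 0 < z.2 ∧ κ z.2 * z.1 ∈ W}, Set.Ioi 0,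
    fun z => M z.2 / m (κ z.2 * z.1), fun z => κ z.2 * z.1 * m (κ z.2 * z.1),
    fun u => 1 - d / (u * k), ?_, ?_, isOpen_Ioi, fun z hz => hz.1, ?_, ?_, ?_, ?_, ?_, ?_, ?_, ?_⟩
  · exact (isOpen_lt continuous_const continuous_snd).inter (hWo.preimage hY.continuous)
  · simpa [h0W] using div_pos hd hk
  · exact (hM.comp contDiff_snd).contDiffOn.div hmY fun z hz => (hm0 _ hz.2).ne'
  · exact hY.contDiffOn.mul hmY
  · refine contDiffOn_const.sub (contDiffOn_const.div (by fun_prop) ?_)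
    exact fun u hu => (mul_pos hu hk).ne'
  · simp
  · field_simp
    simp
  · rintro ⟨t, u⟩ ⟨hu, hW⟩
    refine ⟨div_pos (hMpos u hu) (hm0 _ hW), ?_⟩
    have h1 : DifferentiableAt ℝ (fun y => y * m y) (κ u * t) :=
      differentiableAt_of_deriv_ne_zero (hmd _ hW).ne'
    have h2 : HasDerivAt (fun t => κ u * t) (κ u) t := by
      simpa using (hasDerivAt_id t).const_mul (κ u)
    have h3 := (h1.hasDerivAt.comp t h2).deriv
    have h4 : 0 < deriv (fun y => y * m y) (κ u * t) * κ u := mul_pos (hmd _ hW) (hκpos u hu)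
    rw [← h3] at h4
    exact h4
  · intro u hu
    rw [(hΛ u hu).deriv]
    have : 0 < u := hu
    positivity
  · rintro ⟨t, u⟩ ⟨hu, hW⟩
    have h1 := hme _ hW
    have h2 := (hm0 _ hW).ne'
    simp only at h1 h2 ⊢
    have h3 : Real.tanh (κ u * t) = κ u * t - (κ u * t) ^ 3 * m (κ u * t) ^ 2 := by linarith
    rw [hg t u hu, h3]
    field_simp
    ring

end Germ

/-! ### Spectrum of the adjacency matrix of a connected regular graph. -/

section Network

variable {V : Type*} [Fintype V] [DecidableEq V] (G : SimpleGraph V) [DecidableRel G.Adj]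

/-- The adjacency matrix as an operator on Euclidean space. -/
noncomputable def adjOp : EuclideanSpace ℝ V →L[ℝ] EuclideanSpace ℝ V :=
  Matrix.toEuclideanCLM (n := V) (𝕜 := ℝ) (G.adjMatrix ℝ)

theorem adjOp_apply (x : EuclideanSpace ℝ V) :
    adjOp G x = WithLp.toLp 2 ((G.adjMatrix ℝ).mulVec fun j => x j) := rfl

theorem adjOp_isSymmetric : (adjOp G : EuclideanSpace ℝ V →ₗ[ℝ] EuclideanSpace ℝ V).IsSymmetric :=
  Matrix.isSymmetric_toEuclideanLin_iff.mpr (adjMatrix_isHermitian G)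

variable {G} {k : ℕ} (hreg : G.IsRegularOfDegree k)

include hreg in
theorem adjOp_ones : adjOp G (ones V) = (k : ℝ) • ones V := by
  ext i
  simp [adjOp_apply, ones, SimpleGraph.adjMatrix_mulVec_apply, hreg.degree_eq i]

include hreg in
theorem lapMatrix_mulVec_eq (x : EuclideanSpace ℝ V) :
    WithLp.toLp 2 ((G.lapMatrix ℝ).mulVec fun j => x j) = (k : ℝ) • x - adjOp G x := by
  ext i
  simp [adjOp_apply, SimpleGraph.lapMatrix_mulVec_apply, SimpleGraph.adjMatrix_mulVec_apply,
    hreg.degree_eq i]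

include hreg in
-- The Laplacian `k - A` is positive semidefinite.
theorem inner_adjOp_le (x : EuclideanSpace ℝ V) : inner ℝ x (adjOp G x) ≤ k * ‖x‖ ^ 2 := by
  have h := (G.posSemidef_lapMatrix ℝ).dotProduct_mulVec_nonneg (fun j => x j)
  have h2 : inner ℝ x (WithLp.toLp 2 ((G.lapMatrix ℝ).mulVec fun j => x j)) =
      star (fun j => x j) ⬝ᵥ (G.lapMatrix ℝ).mulVec fun j => x j := by
    rw [EuclideanSpace.inner_eq_star_dotProduct, dotProduct_comm]
  rw [← h2, lapMatrix_mulVec_eq hreg, inner_sub_right, real_inner_smul_right,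
    real_inner_self_eq_norm_sq] at h
  linarith

include hreg in
/-- In a connected regular graph, the eigenspace of the degree is the consensus line. -/
theorem adjOp_eq_smul_iff (hconn : G.Connected) (x : EuclideanSpace ℝ V) :
    adjOp G x = (k : ℝ) • x ↔ x ∈ Submodule.span ℝ {ones V} := by
  constructor
  · intro h
    have h1 : (G.lapMatrix ℝ).mulVec (fun j => x j) = 0 := by
      have := lapMatrix_mulVec_eq hreg x
      rw [h, sub_self] at this
      simpa using congrArg WithLp.ofLp this
    rw [SimpleGraph.lapMatrix_mulVec_eq_zero_iff_forall_reachable] at h1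
    obtain ⟨i⟩ := hconn.nonempty
    refine Submodule.mem_span_singleton.2 ⟨x i, ?_⟩
    ext j
    simpa [ones] using h1 i j (hconn.preconnected i j)
  · intro h
    obtain ⟨a, rfl⟩ := Submodule.mem_span_singleton.1 h
    rw [map_smul, adjOp_ones hreg, smul_comm]

omit [DecidableEq V] in
theorem ones_ne_zero [Nonempty V] : ones V ≠ 0 := by
  intro h
  obtain ⟨i⟩ := ‹Nonempty V›
  have := congrArg (fun x : EuclideanSpace ℝ V => x i) h
  simp [ones] at this

/-- The eigenvectors attached to the sorted eigenvalues of the adjacency matrix. -/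
noncomputable def adjBasis (G : SimpleGraph V) [DecidableRel G.Adj] :
    OrthonormalBasis (Fin (Fintype.card V)) ℝ (EuclideanSpace ℝ V) :=
  (adjOp_isSymmetric G).eigenvectorBasis finrank_euclideanSpace

theorem adjOp_adjBasis (i : Fin (Fintype.card V)) :
    adjOp G (adjBasis G i) = (adjMatrix_isHermitian G).eigenvalues₀ i • adjBasis G i :=
  (adjOp_isSymmetric G).apply_eigenvectorBasis finrank_euclideanSpace i

theorem inner_adjOp_eq_sum (x : EuclideanSpace ℝ V) :
    inner ℝ x (adjOp G x) = ∑ i, (adjMatrix_isHermitian G).eigenvalues₀ i *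
      inner ℝ (adjBasis G i) x ^ 2 := by
  rw [← (adjBasis G).sum_inner_mul_inner]
  refine Finset.sum_congr rfl fun i _ => ?_
  have h : inner ℝ (adjBasis G i) (adjOp G x) = inner ℝ (adjOp G (adjBasis G i)) x :=
    ((adjOp_isSymmetric G) _ _).symm
  rw [h, adjOp_adjBasis, real_inner_smul_left, real_inner_comm]
  ring

theorem norm_sq_eq_sum (x : EuclideanSpace ℝ V) :
    ‖x‖ ^ 2 = ∑ i, inner ℝ (adjBasis G i) x ^ 2 := by
  rw [← real_inner_self_eq_norm_sq, ← (adjBasis G).sum_inner_mul_inner]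
  refine Finset.sum_congr rfl fun i _ => ?_
  rw [real_inner_comm]
  ring

theorem lambdaMin_mul_le (hn : 2 ≤ Fintype.card V) (x : EuclideanSpace ℝ V) :
    lambdaMin G hn * ‖x‖ ^ 2 ≤ inner ℝ x (adjOp G x) := by
  rw [inner_adjOp_eq_sum, norm_sq_eq_sum (G := G), Finset.mul_sum]
  refine Finset.sum_le_sum fun i _ => mul_le_mul_of_nonneg_right ?_ (sq_nonneg _)
  exact (adjMatrix_isHermitian G).eigenvalues₀_antitone (Fin.le_def.2 (by simp; omega))

include hreg in
theorem inner_adjBasis_ones {i : Fin (Fintype.card V)}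
    (hi : (adjMatrix_isHermitian G).eigenvalues₀ i ≠ k) : inner ℝ (adjBasis G i) (ones V) = 0 := by
  have h : inner ℝ (adjOp G (adjBasis G i)) (ones V) = inner ℝ (adjBasis G i) (adjOp G (ones V)) :=
    (adjOp_isSymmetric G) _ _
  rw [adjOp_adjBasis, adjOp_ones hreg, real_inner_smul_left, real_inner_smul_right] at h
  have : ((adjMatrix_isHermitian G).eigenvalues₀ i - k) * inner ℝ (adjBasis G i) (ones V) = 0 := by
    linarith
  exact (mul_eq_zero.1 this).resolve_left (sub_ne_zero.2 hi)

include hreg in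
theorem eigenvalues₀_le (i : Fin (Fintype.card V)) :
    (adjMatrix_isHermitian G).eigenvalues₀ i ≤ k := by
  have h := inner_adjOp_le hreg (adjBasis G i)
  rwa [adjOp_adjBasis, real_inner_smul_right, real_inner_self_eq_norm_sq,
    (adjBasis G).orthonormal.1 i, one_pow, mul_one, mul_one] at h

include hreg in
-- Otherwise every eigenvalue is below `k`, so the ones vector, an eigenvector for `k`, is
-- orthogonal to a whole eigenbasis and vanishes.
theorem eigenvalues₀_zero (hconn : G.Connected) (hn : 2 ≤ Fintype.card V) :
    (adjMatrix_isHermitian G).eigenvalues₀ ⟨0, by omega⟩ = k := by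
  have := hconn.nonempty
  by_contra hne
  have hlt := lt_of_le_of_ne (eigenvalues₀_le hreg _) hne
  refine ones_ne_zero (V := V) (norm_eq_zero.1 (pow_eq_zero_iff two_ne_zero |>.1 ?_))
  rw [norm_sq_eq_sum (G := G)]
  refine Finset.sum_eq_zero fun i _ => pow_eq_zero_iff two_ne_zero |>.2 ?_
  refine inner_adjBasis_ones hreg (ne_of_lt (lt_of_le_of_lt ?_ hlt))
  exact (adjMatrix_isHermitian G).eigenvalues₀_antitone (Fin.le_def.2 (by simp))

include hreg in
theorem adjBasis_mem_span (hconn : G.Connected) {i : Fin (Fintype.card V)}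
    (hi : (adjMatrix_isHermitian G).eigenvalues₀ i = k) :
    adjBasis G i ∈ Submodule.span ℝ {ones V} := by
  rw [← adjOp_eq_smul_iff hreg hconn, adjOp_adjBasis, hi]

include hreg in
-- Equality would put two orthonormal eigenvectors on the one-dimensional consensus line.
theorem lambdaTwo_lt (hconn : G.Connected) (hn : 2 ≤ Fintype.card V) : lambdaTwo G hn < k := by
  refine lt_of_le_of_ne (eigenvalues₀_le hreg _) fun h1 => ?_
  obtain ⟨a, ha⟩ := Submodule.mem_span_singleton.1
    (adjBasis_mem_span hreg hconn (eigenvalues₀_zero hreg hconn hn))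
  obtain ⟨b, hb⟩ := Submodule.mem_span_singleton.1 (adjBasis_mem_span hreg hconn h1)
  have h01 : inner ℝ (adjBasis G ⟨0, by omega⟩) (adjBasis G ⟨1, by omega⟩) = 0 :=
    (adjBasis G).orthonormal.2 (by simp)
  have ha1 : ‖a • ones V‖ = 1 := by rw [ha]; exact (adjBasis G).orthonormal.1 _
  have hb1 : ‖b • ones V‖ = 1 := by rw [hb]; exact (adjBasis G).orthonormal.1 _
  rw [← ha, ← hb, real_inner_smul_left, real_inner_smul_right, real_inner_self_eq_norm_sq] at h01
  rcases mul_eq_zero.1 h01 with h | h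
  · simp [h] at ha1
  · rcases mul_eq_zero.1 h with h | h
    · simp [h] at hb1
    · have : ‖ones V‖ = 0 := by simpa using h
      rw [norm_smul, this] at hb1
      simp at hb1

include hreg in
-- The eigenvector of index `0` is a multiple of the ones vector, so its term drops out of the
-- spectral expansion; all other eigenvalues are at most `λ₂`.
theorem inner_adjOp_le_lambdaTwo (hconn : G.Connected) (hn : 2 ≤ Fintype.card V)
    {x : EuclideanSpace ℝ V} (hx : inner ℝ (ones V) x = 0) :
    inner ℝ x (adjOp G x) ≤ lambdaTwo G hn * ‖x‖ ^ 2 := by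
  rw [inner_adjOp_eq_sum, norm_sq_eq_sum (G := G), Finset.mul_sum]
  refine Finset.sum_le_sum fun i _ => ?_
  rcases Nat.eq_zero_or_pos i.1 with h | h
  · have hi : i = ⟨0, by omega⟩ := Fin.ext h
    obtain ⟨a, ha⟩ := Submodule.mem_span_singleton.1
      (adjBasis_mem_span hreg hconn (eigenvalues₀_zero hreg hconn hn))
    have : inner ℝ (adjBasis G i) x = 0 := by
      rw [hi, ← ha, real_inner_smul_left, hx, mul_zero]
    simp [this]
  · refine mul_le_mul_of_nonneg_right ?_ (sq_nonneg _)
    exact (adjMatrix_isHermitian G).eigenvalues₀_antitone (Fin.le_def.2 h)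

end Network

/-! ### Energy estimates that exclude transverse solutions. -/

section Energy

variable {E : Type*} [NormedAddCommGroup E] [InnerProductSpace ℝ E]

/-- If `e` is an eigenvector of the operator `A`, `u A` is smaller than `d` on `eᗮ`, and
`y` is a firmly nonexpansive image of `β ∈ eᗮ`, then `-d β + u A y ∈ span e` forces `β = 0`. -/
theorem eq_zero_of_neg_smul_add_smul_map_mem {A : E →L[ℝ] E} {e : E} {κ : ℝ} (he : e ≠ 0)
    (hAe : A e = κ • e) {d u c : ℝ} (hd : 0 < d) (hc : c < d)
    (hq : ∀ z : E, inner ℝ e z = 0 → u * inner ℝ z (A z) ≤ c * ‖z‖ ^ 2)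
    {β y : E} (hβ : inner ℝ e β = 0) (hy : ‖y‖ ^ 2 ≤ inner ℝ β y)
    (h : ∃ s : ℝ, -(d • β) + u • A y = s • e) : β = 0 := by
  obtain ⟨s, hs⟩ := h
  have hee : 0 < inner ℝ e e := real_inner_self_pos.2 he
  -- `z` is the component of `y` orthogonal to `e`. Pairing the equation with `z` kills both `s • e`
  -- and the part of `A y` along `e`.
  set a : ℝ := inner ℝ e y / inner ℝ e e with ha
  set z : E := y - a • e with hz
  have hez : inner ℝ e z = 0 := by
    rw [hz, inner_sub_right, real_inner_smul_right, ha, div_mul_cancel₀ _ hee.ne', sub_self]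
  have hyz : y = z + a • e := by rw [hz]; abel
  have h1 : ‖z‖ ^ 2 ≤ ‖y‖ ^ 2 := by
    rw [hyz, ← real_inner_self_eq_norm_sq, ← real_inner_self_eq_norm_sq, inner_add_add_self,
      real_inner_smul_right, real_inner_smul_left, real_inner_smul_left, real_inner_smul_right,
      real_inner_comm e z, hez]
    nlinarith [mul_nonneg (sq_nonneg a) hee.le]
  have h2 : inner ℝ β y = inner ℝ z β := by
    rw [hyz, inner_add_right, real_inner_smul_right, real_inner_comm e β, hβ, real_inner_comm]
    ring
  have h3 : d * inner ℝ z β = u * inner ℝ z (A z) := by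
    have h4 := congrArg (fun x => inner ℝ z x) hs
    simp only [inner_add_right, inner_neg_right, real_inner_smul_right, hyz, map_add, map_smul,
      hAe, real_inner_comm e z, hez] at h4
    linarith
  -- The chain is `d ‖z‖² ≤ d ⟪z, β⟫ = u ⟪z, A z⟫ ≤ c ‖z‖²` with `c < d`.
  have h5 : ‖z‖ ^ 2 ≤ 0 := by
    have := hq z hez
    nlinarith
  have hz0 : z = 0 := by
    have : ‖z‖ = 0 := pow_eq_zero_iff two_ne_zero |>.1 (le_antisymm h5 (sq_nonneg _))
    exact norm_eq_zero.1 this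
  -- With `z = 0`, `A y` lies along `e`, so pairing the equation with `β` leaves only the damping
  -- term.
  have h6 : d * inner ℝ β β = 0 := by
    have h4 := congrArg (fun x => inner ℝ β x) hs
    simp only [inner_add_right, inner_neg_right, real_inner_smul_right, hyz, map_add, map_smul,
      hAe, real_inner_comm e β, hβ, hz0, map_zero, inner_zero_right] at h4
    linarith
  exact inner_self_eq_zero.1 ((mul_eq_zero.1 h6).resolve_left hd.ne')

/-- If `e` is an eigenvector of the symmetric operator `A`, `u A` is smaller than `d` on `eᗮ`, and
`y` is a firmly nonexpansive image of `u A β` with `β ∈ eᗮ`, then `-d β + y ∈ span e` forces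
`β = 0`. -/
theorem eq_zero_of_neg_smul_add_mem {A : E →L[ℝ] E} (hA : (A : E →ₗ[ℝ] E).IsSymmetric)
    {e : E} {κ : ℝ} (hAe : A e = κ • e) {d u c : ℝ} (hd : 0 < d) (hc : c < d)
    (hq : ∀ z : E, inner ℝ e z = 0 → u * inner ℝ z (A z) ≤ c * ‖z‖ ^ 2)
    {β y : E} (hβ : inner ℝ e β = 0) (hy : ‖y‖ ^ 2 ≤ inner ℝ (u • A β) y)
    (h : ∃ s : ℝ, -(d • β) + y = s • e) : β = 0 := by
  obtain ⟨s, hs⟩ := h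
  have hyz : y = d • β + s • e := by rw [← hs]; abel
  have heA : inner ℝ (A β) e = 0 := by
    have : inner ℝ (A β) e = inner ℝ β (A e) := hA β e
    rw [this, hAe, real_inner_smul_right, real_inner_comm, hβ, mul_zero]
  have h1 : inner ℝ (u • A β) y = d * (u * inner ℝ β (A β)) := by
    rw [hyz, inner_add_right, real_inner_smul_left, real_inner_smul_left, real_inner_smul_right,
      real_inner_smul_right, heA, real_inner_comm]
    ring
  -- Pythagoras for `y = d • β + s • e`. Combined with `hy` and `h1` it bounds `d ‖β‖²` by `u ⟪β, A
  -- β⟫ ≤ c ‖β‖²`.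
  have h2 : d ^ 2 * ‖β‖ ^ 2 ≤ ‖y‖ ^ 2 := by
    rw [hyz, ← real_inner_self_eq_norm_sq, ← real_inner_self_eq_norm_sq, inner_add_add_self]
    simp only [real_inner_smul_left, real_inner_smul_right, real_inner_comm e β, hβ]
    nlinarith [mul_nonneg (sq_nonneg s) (real_inner_self_nonneg (x := e))]
  have h3 := hq β hβ
  have h4 : ‖β‖ ^ 2 ≤ 0 := by
    have h5 : d * (d * ‖β‖ ^ 2) ≤ d * (c * ‖β‖ ^ 2) := by
      calc d * (d * ‖β‖ ^ 2) = d ^ 2 * ‖β‖ ^ 2 := by ring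
        _ ≤ d * (u * inner ℝ β (A β)) := (h2.trans hy).trans h1.le
        _ ≤ _ := mul_le_mul_of_nonneg_left h3 hd.le
    have h6 := le_of_mul_le_mul_left h5 hd
    nlinarith
  exact norm_eq_zero.1 (pow_eq_zero_iff two_ne_zero |>.1 (le_antisymm h4 (sq_nonneg _)))

end Energy

/-! ### Lyapunov–Schmidt reduction along an invariant critical line. -/

section Reduction

variable {E : Type*} [NormedAddCommGroup E] [InnerProductSpace ℝ E] [FiniteDimensional ℝ E]

theorem abs_sub_lt_of_mem_parBall {Φ : E → ℝ → E} {us R : ℝ} {z : critSpace Φ 0 us × ℝ}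
    (hz : z ∈ parBall Φ 0 us R) : |z.2 - us| < R := by
  refine lt_of_le_of_lt ?_ hz
  exact Real.abs_le_sqrt (le_add_of_nonneg_left (sq_nonneg _))

/-- If the critical line is invariant and every state off it has a nonzero transverse velocity,
then the reduction is valid with the zero implicit map. -/
theorem isValidReduction_zero {Φ : E → ℝ → E} {us R ρ : ℝ} {e : E} (hρ : 0 < ρ)
    (hsymm : (jac Φ 0 us).IsSymmetric) (hker : critSpace Φ 0 us = Submodule.span ℝ {e})
    (hinv : ∀ a u : ℝ, ∃ s : ℝ, Φ (a • e) u = s • e)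
    (huniq : ∀ (a u : ℝ) (β : E), |u - us| < R → inner ℝ e β = 0 →
      (∃ s : ℝ, Φ (a • e + β) u = s • e) → β = 0) :
    IsValidReduction Φ 0 us R ρ 0 := by
  have hrange : (rangeSpace Φ 0 us)ᗮ = Submodule.span ℝ {e} := by
    rw [← hker]; exact hsymm.orthogonal_range
  -- By symmetry of the Jacobian, the kernel of the projection to its range is the critical line
  -- itself.
  have hP : ∀ x : E, (rangeSpace Φ 0 us).starProjection x = 0 ↔ ∃ s : ℝ, x = s • e := by
    intro x
    rw [Submodule.starProjection_apply_eq_zero_iff, hrange, Submodule.mem_span_singleton]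
    simp only [eq_comm]
  have hmem : ∀ α : critSpace Φ 0 us, ∃ a : ℝ, (α : E) = a • e := by
    intro α
    obtain ⟨a, ha⟩ := Submodule.mem_span_singleton.1 (hker.le α.2)
    exact ⟨a, ha.symm⟩
  have hperp : ∀ β : (critSpace Φ 0 us)ᗮ, inner ℝ e (β : E) = 0 := by
    intro β
    refine Submodule.inner_right_of_mem_orthogonal (K := critSpace Φ 0 us) ?_ β.2
    rw [hker]
    exact Submodule.mem_span_singleton_self e
  have hsolve : ∀ z ∈ parBall Φ 0 us R, ∀ β ∈ perpBall Φ 0 us ρ,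
      (rangeSpace Φ 0 us).starProjection (Φ (z.1 + β) z.2) = 0 ↔ β = 0 := by
    intro z hz β _
    obtain ⟨a, ha⟩ := hmem z.1
    rw [hP, ha]
    constructor
    · intro h
      exact Subtype.ext (huniq a z.2 β (abs_sub_lt_of_mem_parBall hz) (hperp β) h)
    · rintro rfl
      simpa using hinv a z.2
  refine ⟨contDiffOn_const, ?_, by simp, hsolve, ?_⟩
  · intro z _
    simpa [perpBall] using hρ
  · intro z hz β hβ
    constructor
    · intro h
      have h0 : β = 0 := (hsolve z hz β hβ).1 (by rw [h, map_zero])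
      subst h0
      refine ⟨rfl, ?_⟩
      simp only [Pi.zero_apply]
      rw [h, map_zero]
    · rintro ⟨rfl, h⟩
      simp only [Pi.zero_apply] at h ⊢
      obtain ⟨a, ha⟩ := hmem z.1
      have h1 : Φ (z.1 + ((0 : (critSpace Φ 0 us)ᗮ) : E)) z.2 ∈ (rangeSpace Φ 0 us)ᗮ := by
        rw [hrange, Submodule.mem_span_singleton, ha]
        obtain ⟨s, hs⟩ := hinv a z.2
        exact ⟨s, by simpa using hs.symm⟩
      rwa [Submodule.starProjection_eq_self_iff.2 h1] at h

/-- The characteristic polynomial of a symmetric operator splits over `ℝ`, so each complex root is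
real. -/
theorem re_ne_zero_of_isSymmetric {J : E →ₗ[ℝ] E} (hJ : J.IsSymmetric) {μ : ℂ}
    (hμ : Polynomial.aeval μ J.charpoly = 0) (h0 : μ ≠ 0) : μ.re ≠ 0 := by
  rw [hJ.charpoly_eq rfl, map_prod, Finset.prod_eq_zero_iff] at hμ
  obtain ⟨i, -, hi⟩ := hμ
  simp only [map_sub, Polynomial.aeval_X, Polynomial.aeval_C, sub_eq_zero] at hi
  rw [hi] at h0 ⊢
  simpa using h0

omit [FiniteDimensional ℝ E] in
-- Symmetric operators are semisimple, so generalized eigenvectors are eigenvectors.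
theorem finrank_maxGenEigenspace_zero {J : E →ₗ[ℝ] E} (hJ : J.IsSymmetric) :
    Module.finrank ℝ (Module.End.maxGenEigenspace J 0) = Module.finrank ℝ (LinearMap.ker J) := by
  rw [hJ.isFinitelySemisimple.maxGenEigenspace_eq_eigenspace, Module.End.eigenspace_zero]

/-- A pitchfork whose critical line is invariant, so that the reduced function is the restriction of
the field to this line. -/
theorem isSupercriticalPitchfork_of_invariant_line {Φ : E → ℝ → E} {us R : ℝ} {e : E}
    (he : ‖e‖ = 1) (hR : 0 < R)
    (hsymm : (jac Φ 0 us).IsSymmetric) (hker : critSpace Φ 0 us = Submodule.span ℝ {e})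
    {γ : ℝ → ℝ → ℝ} (hinv : ∀ a u : ℝ, Φ (a • e) u = γ a u • e)
    (huniq : ∀ (a u : ℝ) (β : E), |u - us| < R → inner ℝ e β = 0 →
      (∃ s : ℝ, Φ (a • e + β) u = s • e) → β = 0)
    (h0 : Φ 0 us = 0) (hγ : IsSupercriticalPitchforkGerm γ 0 us) :
    IsSupercriticalPitchfork Φ 0 us := by
  have he0 : e ≠ 0 := by
    rintro rfl
    simp at he
  have hrank : Module.finrank ℝ (critSpace Φ 0 us) = 1 := by
    rw [hker, finrank_span_singleton he0]
  have hmem : e ∈ Submodule.span ℝ {e} := Submodule.mem_span_singleton_self e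
  have hrange : (rangeSpace Φ 0 us)ᗮ = Submodule.span ℝ {e} := by
    rw [← hker]; exact hsymm.orthogonal_range
  refine ⟨h0, hrank, (finrank_maxGenEigenspace_zero hsymm).trans hrank,
    fun μ hμ => re_ne_zero_of_isSymmetric hsymm hμ, ⟨e, hker ▸ hmem⟩, ⟨e, hrange ▸ hmem⟩, R, 1, 0,
    he, he, ?_, hR, one_pos,
    isValidReduction_zero one_pos hsymm hker (fun a u => ⟨_, hinv a u⟩) huniq, ?_⟩
  · simp [he]
  · have : (fun t u => inner ℝ e (Φ (t • e) u)) = γ := by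
      funext t u
      rw [hinv, real_inner_smul_right, real_inner_self_eq_norm_sq, he]
      ring
    simpa [inner_zero_right, this] using hγ

end Reduction

/-! ### The two models of opinion dynamics and the range of `u`. -/

section Dynamics

variable {V : Type*} [Fintype V]

/-- Entrywise `tanh` on Euclidean space. -/
noncomputable def tanhMap (x : EuclideanSpace ℝ V) : EuclideanSpace ℝ V :=
  WithLp.toLp 2 fun i => Real.tanh (x i)

theorem norm_sq_tanhMap_sub_le (x y : EuclideanSpace ℝ V) :
    ‖tanhMap x - tanhMap y‖ ^ 2 ≤ inner ℝ (x - y) (tanhMap x - tanhMap y) := by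
  rw [EuclideanSpace.real_norm_sq_eq, PiLp.inner_apply]
  refine Finset.sum_le_sum fun i _ => ?_
  have h := sq_tanh_sub_le (x i) (y i)
  simp only [tanhMap, PiLp.sub_apply, RCLike.inner_apply, conj_trivial]
  linarith

theorem tanhMap_smul_ones (a : ℝ) : tanhMap (a • ones V) = Real.tanh a • ones V := by
  ext i
  simp [tanhMap, ones]

/-- Since `tanh' 0 = 1`, both models share the linearization `-d + u A` at the origin. -/
theorem hasFDerivAt_tanhMap_zero :
    HasFDerivAt (tanhMap (V := V)) (ContinuousLinearMap.id ℝ (EuclideanSpace ℝ V)) 0 := by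
  rw [← hasFDerivWithinAt_univ, hasFDerivWithinAt_euclidean]
  intro i
  rw [hasFDerivWithinAt_univ]
  have h1 : HasFDerivAt (fun x : EuclideanSpace ℝ V => x i)
      (EuclideanSpace.proj (𝕜 := ℝ) i : EuclideanSpace ℝ V →L[ℝ] ℝ) 0 :=
    (EuclideanSpace.proj (𝕜 := ℝ) i : EuclideanSpace ℝ V →L[ℝ] ℝ).hasFDerivAt
  have h2 := (hasDerivAt_tanh ((0 : EuclideanSpace ℝ V) i)).comp_hasFDerivAt 0 h1
  refine h2.congr_fderiv ?_
  ext x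
  simp

variable [DecidableEq V] (G : SimpleGraph V) [DecidableRel G.Adj] (d : ℝ)

theorem hopfieldNOD_eq (x : EuclideanSpace ℝ V) (u : ℝ) :
    hopfieldNOD G d x u = -(d • x) + u • adjOp G (tanhMap x) := rfl

theorem firingNOD_eq (x : EuclideanSpace ℝ V) (u : ℝ) :
    firingNOD G d x u = -(d • x) + tanhMap (u • adjOp G x) := rfl

/-- The linearization `-d + u A` of nonlinear opinion dynamics at the origin. -/
noncomputable def linearization (u : ℝ) : EuclideanSpace ℝ V →ₗ[ℝ] EuclideanSpace ℝ V :=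
  (-(d • ContinuousLinearMap.id ℝ (EuclideanSpace ℝ V)) + u • adjOp G :
    EuclideanSpace ℝ V →L[ℝ] EuclideanSpace ℝ V)

theorem linearization_apply (u : ℝ) (x : EuclideanSpace ℝ V) :
    linearization G d u x = -(d • x) + u • adjOp G x := rfl

theorem jac_hopfieldNOD (u : ℝ) : jac (hopfieldNOD G d) 0 u =
    linearization G d u := by
  have h : HasFDerivAt (fun x => hopfieldNOD G d x u)
      (-(d • ContinuousLinearMap.id ℝ (EuclideanSpace ℝ V)) +
        u • (adjOp G).comp (ContinuousLinearMap.id ℝ (EuclideanSpace ℝ V))) 0 :=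
    ((hasFDerivAt_id (0 : EuclideanSpace ℝ V)).const_smul d).neg.add
      (((adjOp G).hasFDerivAt.comp 0 hasFDerivAt_tanhMap_zero).const_smul u)
  rw [jac, h.fderiv, ContinuousLinearMap.comp_id, linearization]

theorem jac_firingNOD (u : ℝ) : jac (firingNOD G d) 0 u =
    linearization G d u := by
  have h1 : HasFDerivAt (tanhMap (V := V)) (ContinuousLinearMap.id ℝ (EuclideanSpace ℝ V))
      ((u • adjOp G) 0) := by
    rw [map_zero]
    exact hasFDerivAt_tanhMap_zero
  have h : HasFDerivAt (fun x => firingNOD G d x u)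
      (-(d • ContinuousLinearMap.id ℝ (EuclideanSpace ℝ V)) +
        (ContinuousLinearMap.id ℝ (EuclideanSpace ℝ V)).comp (u • adjOp G)) 0 :=
    ((hasFDerivAt_id (0 : EuclideanSpace ℝ V)).const_smul d).neg.add
      (h1.comp 0 (u • adjOp G).hasFDerivAt)
  rw [jac, h.fderiv, ContinuousLinearMap.id_comp, linearization]

theorem linearization_isSymmetric (u : ℝ) :
    (linearization G d u).IsSymmetric := by
  intro x y
  have h : inner ℝ (adjOp G x) y = inner ℝ x (adjOp G y) := adjOp_isSymmetric G x y
  simp [linearization_apply, inner_add_left, inner_add_right, real_inner_smul_left,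
    real_inner_smul_right, h]

variable {G d} {k : ℕ} (hreg : G.IsRegularOfDegree k)

include hreg in
theorem ker_linearization (hconn : G.Connected) (hk : 0 < k) (hd : 0 < d) :
    LinearMap.ker (linearization G d (d / k)) =
      Submodule.span ℝ {ones V} := by
  ext x
  rw [← adjOp_eq_smul_iff hreg hconn, LinearMap.mem_ker]
  have hk' : (k : ℝ) ≠ 0 := by exact_mod_cast hk.ne'
  have h : linearization G d (d / k) x =
      (d / k) • (adjOp G x - (k : ℝ) • x) := by
    rw [linearization_apply, smul_sub, smul_smul, div_mul_cancel₀ _ hk']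
    abel
  rw [h, smul_eq_zero, or_iff_right (div_ne_zero hd.ne' hk'), sub_eq_zero]

include hreg in
theorem hopfieldNOD_smul_ones (a u : ℝ) :
    hopfieldNOD G d (a • ones V) u = (-(d * a) + u * (k * Real.tanh a)) • ones V := by
  rw [hopfieldNOD_eq, tanhMap_smul_ones, map_smul, adjOp_ones hreg]
  module

include hreg in
theorem firingNOD_smul_ones (a u : ℝ) :
    firingNOD G d (a • ones V) u = (-(d * a) + Real.tanh (u * (k * a))) • ones V := by
  rw [firingNOD_eq, map_smul, adjOp_ones hreg,
    show u • a • (k : ℝ) • ones V = (u * (k * a)) • ones V by module, tanhMap_smul_ones]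
  module

include hreg in
theorem hopfieldNOD_transverse [Nonempty V] (hd : 0 < d) {u c : ℝ} (hc : c < d)
    (hq : ∀ z, inner ℝ (ones V) z = 0 → u * inner ℝ z (adjOp G z) ≤ c * ‖z‖ ^ 2)
    {a : ℝ} {β : EuclideanSpace ℝ V} (hβ : inner ℝ (ones V) β = 0)
    (h : ∃ s : ℝ, hopfieldNOD G d (a • ones V + β) u = s • ones V) : β = 0 := by
  obtain ⟨s, hs⟩ := h
  refine eq_zero_of_neg_smul_add_smul_map_mem ones_ne_zero (adjOp_ones hreg) hd hc hq hβ
    -- Subtracting the field at `a • ones`, which lies on the line, turns the hypothesis into an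
    -- equation for the increment of `tanh`.
    (y := tanhMap (a • ones V + β) - tanhMap (a • ones V)) ?_
    ⟨s - (-(d * a) + u * (k * Real.tanh a)), ?_⟩
  · simpa using norm_sq_tanhMap_sub_le (a • ones V + β) (a • ones V)
  · rw [sub_smul, ← hs, ← hopfieldNOD_smul_ones hreg, hopfieldNOD_eq, hopfieldNOD_eq, map_sub]
    module

include hreg in
theorem firingNOD_transverse (hd : 0 < d) {u c : ℝ} (hc : c < d)
    (hq : ∀ z, inner ℝ (ones V) z = 0 → u * inner ℝ z (adjOp G z) ≤ c * ‖z‖ ^ 2)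
    {a : ℝ} {β : EuclideanSpace ℝ V} (hβ : inner ℝ (ones V) β = 0)
    (h : ∃ s : ℝ, firingNOD G d (a • ones V + β) u = s • ones V) : β = 0 := by
  obtain ⟨s, hs⟩ := h
  refine eq_zero_of_neg_smul_add_mem (adjOp_isSymmetric G) (adjOp_ones hreg) hd hc hq hβ
    (y := tanhMap (u • adjOp G (a • ones V + β)) - tanhMap (u • adjOp G (a • ones V))) ?_
    ⟨s - (-(d * a) + Real.tanh (u * (k * a))), ?_⟩
  · have h := norm_sq_tanhMap_sub_le (u • adjOp G (a • ones V + β)) (u • adjOp G (a • ones V))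
    rwa [← smul_sub, ← map_sub, add_sub_cancel_left] at h
  · rw [sub_smul, ← hs, ← firingNOD_smul_ones hreg, firingNOD_eq, firingNOD_eq]
    module

include hreg in
theorem exists_bound_of_pos (hconn : G.Connected) (hn : 2 ≤ Fintype.card V) {u : ℝ} (hu : 0 < u)
    (h : u * lambdaTwo G hn < d) : ∃ c < d, ∀ z, inner ℝ (ones V) z = 0 →
      u * inner ℝ z (adjOp G z) ≤ c * ‖z‖ ^ 2 :=
  ⟨_, h, fun z hz => by
    rw [mul_assoc]
    exact mul_le_mul_of_nonneg_left (inner_adjOp_le_lambdaTwo hreg hconn hn hz) hu.le⟩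

include hreg in
-- The pitchfork needs only some neighbourhood of `d / k`, and continuity provides it because `(d /
-- k) λ₂ < d`.
theorem exists_radius_bound (hconn : G.Connected) (hn : 2 ≤ Fintype.card V) (hk : 0 < k)
    (hd : 0 < d) : ∃ R > 0, ∀ u : ℝ, |u - d / k| < R → ∃ c < d, ∀ z, inner ℝ (ones V) z = 0 →
      u * inner ℝ z (adjOp G z) ≤ c * ‖z‖ ^ 2 := by
  have hk' : (0 : ℝ) < k := by exact_mod_cast hk
  have h1 : ∀ᶠ u in nhds (d / k), 0 < u := lt_mem_nhds (div_pos hd hk')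
  have h2 : ∀ᶠ u in nhds (d / k), u * lambdaTwo G hn < d := by
    have hc : ContinuousAt (fun u : ℝ => u * lambdaTwo G hn) (d / k) := by fun_prop
    refine hc.eventually (gt_mem_nhds ?_)
    change d / k * lambdaTwo G hn < d
    rw [div_mul_eq_mul_div, div_lt_iff₀ hk']
    exact mul_lt_mul_of_pos_left (lambdaTwo_lt hreg hconn hn) hd
  obtain ⟨R, hR, h⟩ := Metric.eventually_nhds_iff.1 (h1.and h2)
  exact ⟨R, hR, fun u hu =>
    exists_bound_of_pos hreg hconn hn (h (y := u) (by rwa [Real.dist_eq])).1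
      (h (y := u) (by rwa [Real.dist_eq])).2⟩

include hreg in
theorem exists_bound_of_abs_sub_lt (hconn : G.Connected) (hn : 2 ≤ Fintype.card V) (hk : 0 < k)
    (hd : 0 < d) {R : ℝ} (hR0 : 0 < R)
    (hR : R < d * (k - lambdaTwo G hn) / (k * lambdaPrime G hn)) {u : ℝ} (hu : |u - d / k| < R) :
    ∃ c < d, ∀ z, inner ℝ (ones V) z = 0 → u * inner ℝ z (adjOp G z) ≤ c * ‖z‖ ^ 2 := by
  have hk' : (0 : ℝ) < k := by exact_mod_cast hk
  have hL2 : |lambdaTwo G hn| ≤ lambdaPrime G hn := le_max_left _ _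
  have hLn : |lambdaMin G hn| ≤ lambdaPrime G hn := le_max_right _ _
  have hL : 0 < lambdaPrime G hn := by
    -- If `λ'` were `0`, division by zero would make the upper bound on `R` equal to `0`,
    -- contradicting `0 < R`.
    refine lt_of_le_of_ne ((abs_nonneg _).trans hL2) fun h => ?_
    rw [← h, mul_zero, div_zero] at hR
    exact lt_asymm hR hR0
  rw [lt_div_iff₀ (mul_pos hk' hL)] at hR
  obtain ⟨hu1, hu2⟩ := abs_lt.1 hu
  have hdk : d / k * k = d := div_mul_cancel₀ _ hk'.ne'
  rcases lt_or_ge 0 u with hpos | hneg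
  · refine exists_bound_of_pos hreg hconn hn hpos ?_
    rcases le_or_gt (lambdaTwo G hn) 0 with h | h
    · exact lt_of_le_of_lt (mul_nonpos_of_nonneg_of_nonpos hpos.le h) hd
    -- For `λ₂ > 0`, `u k λ₂ < d λ₂ + R k λ' < d λ₂ + d (k - λ₂) = d k`: this is where the stated
    -- radius comes from.
    · have h1 : u * k < d + R * k := by nlinarith
      have h2 : u * k * lambdaTwo G hn < (d + R * k) * lambdaTwo G hn :=
        mul_lt_mul_of_pos_right h1 h
      have h3 : R * k * lambdaTwo G hn ≤ R * k * lambdaPrime G hn :=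
        mul_le_mul_of_nonneg_left ((le_abs_self _).trans hL2) (by positivity)
      refine lt_of_mul_lt_mul_right (a := (k : ℝ)) ?_ hk'.le
      linarith
  -- The ball may reach `u ≤ 0`, where the smallest eigenvalue governs `u A`. Here `-u k λ' < d (k -
  -- λ₂) - d λ' ≤ d k`, using `-λ₂ ≤ λ'`.
  · refine ⟨-u * lambdaPrime G hn, ?_, fun z _ => ?_⟩
    · have h1 : -u * k < R * k - d := by nlinarith
      have h2 : -u * k * lambdaPrime G hn < (R * k - d) * lambdaPrime G hn :=
        mul_lt_mul_of_pos_right h1 hL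
      have h3 : d * -lambdaTwo G hn ≤ d * lambdaPrime G hn :=
        mul_le_mul_of_nonneg_left ((neg_le_abs _).trans hL2) hd.le
      refine lt_of_mul_lt_mul_right (a := (k : ℝ)) ?_ hk'.le
      linarith
    · calc u * inner ℝ z (adjOp G z) ≤ u * (lambdaMin G hn * ‖z‖ ^ 2) :=
            mul_le_mul_of_nonpos_left (lambdaMin_mul_le hn z) hneg
        _ = -u * -lambdaMin G hn * ‖z‖ ^ 2 := by ring
        _ ≤ -u * lambdaPrime G hn * ‖z‖ ^ 2 := by
            refine mul_le_mul_of_nonneg_right ?_ (sq_nonneg _)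
            exact mul_le_mul_of_nonneg_left ((neg_le_abs _).trans hLn) (by linarith)

include hreg in
/-- The pitchfork and the domain of validity, for a family with the linearization of nonlinear
opinion dynamics at the origin, an invariant consensus line and no equilibria transverse to it. -/
theorem pitchfork_and_validity (hconn : G.Connected) (hn : 2 ≤ Fintype.card V)
    (hk : 0 < k) (hd : 0 < d) {Φ : EuclideanSpace ℝ V → ℝ → EuclideanSpace ℝ V}
    (hjac : jac Φ 0 (d / k) =
      linearization G d (d / k))
    {γ : ℝ → ℝ → ℝ} (hinv : ∀ a u : ℝ, Φ (a • ones V) u = γ a u • ones V)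
    (hγ0 : γ 0 (d / k) = 0)
    (htrans : ∀ u c : ℝ, c < d →
      (∀ z, inner ℝ (ones V) z = 0 → u * inner ℝ z (adjOp G z) ≤ c * ‖z‖ ^ 2) →
      ∀ (a : ℝ) (β : EuclideanSpace ℝ V), inner ℝ (ones V) β = 0 →
        (∃ s : ℝ, Φ (a • ones V + β) u = s • ones V) → β = 0)
    (hγ : ∀ s : ℝ, 0 < s →
      IsSupercriticalPitchforkGerm (fun t u => s * γ (t * s⁻¹) u) 0 (d / k)) :
    IsSupercriticalPitchfork Φ 0 (d / k) ∧
      critSpace Φ 0 (d / k) = Submodule.span ℝ {ones V} ∧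
      ∀ Rpar Rperp : ℝ, 0 < Rpar →
        Rpar < d * (k - lambdaTwo G hn) / (k * lambdaPrime G hn) → 0 < Rperp →
        ∃ φ, IsValidReduction Φ 0 (d / k) Rpar Rperp φ := by
  have := hconn.nonempty
  have hsymm : (jac Φ 0 (d / k)).IsSymmetric := by
    rw [hjac]; exact linearization_isSymmetric G d (d / k)
  have hker : critSpace Φ 0 (d / k) = Submodule.span ℝ {ones V} := by
    rw [critSpace, hjac]; exact ker_linearization hreg hconn hk hd
  refine ⟨?_, hker, fun Rpar Rperp h0 h1 h2 => ⟨0, isValidReduction_zero h2 hsymm hker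
    (fun a u => ⟨_, hinv a u⟩) fun a u β hu hβ h => ?_⟩⟩
  · obtain ⟨R, hR, hb⟩ := exists_radius_bound hreg hconn hn hk hd
    -- The reduced function is defined with unit vectors, so the coordinate along the ones vector is
    -- rescaled by its norm; hence the factor `s` in `hγ`.
    have hs : 0 < ‖ones V‖ := norm_pos_iff.2 ones_ne_zero
    have hes : ∀ t : ℝ, t • ‖ones V‖⁻¹ • ones V = (t * ‖ones V‖⁻¹) • ones V := fun t => smul_smul ..
    refine isSupercriticalPitchfork_of_invariant_line (e := ‖ones V‖⁻¹ • ones V) ?_ hR hsymm ?_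
      (fun a u => ?_) (fun a u β hu hβ h => ?_) ?_ (hγ _ hs)
    · rw [norm_smul, norm_inv, norm_norm, inv_mul_cancel₀ hs.ne']
    · rw [hker, Submodule.span_singleton_smul_eq (inv_ne_zero hs.ne').isUnit]
    · rw [hes, hinv, smul_smul]
      congr 1
      field_simp
    · obtain ⟨c, hc, hq⟩ := hb u hu
      rw [real_inner_smul_left] at hβ
      obtain ⟨s, hs'⟩ := h
      rw [hes, hes] at hs'
      exact htrans u c hc hq _ β ((mul_eq_zero.1 hβ).resolve_left (inv_ne_zero hs.ne')) ⟨_, hs'⟩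
    · simpa [hγ0] using hinv 0 (d / k)
  · obtain ⟨c, hc, hq⟩ := exists_bound_of_abs_sub_lt hreg hconn hn hk hd h0 h1 hu
    exact htrans u c hc hq a β hβ h

end Dynamics

end LSR

theorem mainTheorem4 {V : Type*} [Fintype V] [DecidableEq V]
    (G : SimpleGraph V) [DecidableRel G.Adj] (hconn : G.Connected)
    (k : ℕ) (hreg : G.IsRegularOfDegree k) (hn : 2 ≤ Fintype.card V)
    (d : ℝ) (hd : 0 < d) :
    (LSR.IsSupercriticalPitchfork (LSR.hopfieldNOD G d) 0 (d / k) ∧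
      LSR.critSpace (LSR.hopfieldNOD G d) 0 (d / k) = Submodule.span ℝ {LSR.ones V} ∧
      ∀ Rpar Rperp : ℝ, 0 < Rpar →
        Rpar < d * (k - LSR.lambdaTwo G hn) / (k * LSR.lambdaPrime G hn) → 0 < Rperp →
        ∃ φ, LSR.IsValidReduction (LSR.hopfieldNOD G d) 0 (d / k) Rpar Rperp φ) ∧
    (LSR.IsSupercriticalPitchfork (LSR.firingNOD G d) 0 (d / k) ∧
      LSR.critSpace (LSR.firingNOD G d) 0 (d / k) = Submodule.span ℝ {LSR.ones V} ∧
      ∀ Rpar Rperp : ℝ, 0 < Rpar →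
        Rpar < d * (k - LSR.lambdaTwo G hn) / (k * LSR.lambdaPrime G hn) → 0 < Rperp →
        ∃ φ, LSR.IsValidReduction (LSR.firingNOD G d) 0 (d / k) Rpar Rperp φ) := by
  have hne := hconn.nonempty
  have hk : 0 < k := by
    have : Nontrivial V := Fintype.one_lt_card_iff_nontrivial.1 hn
    obtain ⟨i⟩ := hne
    rw [← hreg.degree_eq i]
    exact hconn.preconnected.degree_pos_of_nontrivial i
  have hk' : (0 : ℝ) < k := by exact_mod_cast hk
  constructor
  · refine LSR.pitchfork_and_validity hreg hconn hn hk hd (LSR.jac_hopfieldNOD G d _)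
      (LSR.hopfieldNOD_smul_ones hreg) (by simp)
      (fun u c hc hq a β hβ h => LSR.hopfieldNOD_transverse hreg hd hc hq hβ h) fun s hs => ?_
    -- With `y = t / s`, `s (-d y + u k tanh y) = s u k (tanh y - (d / (u k)) y)`.
    refine LSR.isSupercriticalPitchforkGerm_of_tanh hd hk' (M := fun u => s * (u * k))
      (κ := fun _ => s⁻¹) (by fun_prop) (by fun_prop) (fun u hu => by positivity)
      (fun u _ => by positivity) fun t u hu => ?_
    rw [mul_comm t s⁻¹]
    field_simp
    ring
  · refine LSR.pitchfork_and_validity hreg hconn hn hk hd (LSR.jac_firingNOD G d _)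
      (LSR.firingNOD_smul_ones hreg) (by simp)
      (fun u c hc hq a β hβ h => LSR.firingNOD_transverse hreg hd hc hq hβ h) fun s hs => ?_
    -- The gain is now inside `tanh`: with `y = u k t / s`, the damping term `d t / s` equals `(d /
    -- (u k)) y`.
    refine LSR.isSupercriticalPitchforkGerm_of_tanh hd hk' (M := fun _ => s)
      (κ := fun u => u * k * s⁻¹) (by fun_prop) (by fun_prop) (fun u _ => by positivity)
      (fun u hu => by positivity) fun t u hu => ?_
    rw [show u * k * s⁻¹ * t = u * (k * (t * s⁻¹)) by ring]
    field_simp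
    ring
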